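/- Let $\eta(z)=e^{\pi i z/12}\prod_{n\ge1}(1-e^{2\pi i n z})$ on the upper half-plane $\mathbb H$. An eta quotient is a finite product $f=\prod_{d\ge1}\eta_d^{X_d}$, where $\eta_d(z)=\eta(dz)$ and $X_d\in\mathbb Z$; its weight is $\frac12\sum_d X_d$ and its level is $\operatorname{lcm}\{d: X_d\ne0\}$. It is holomorphic if it has no pole at any cusp. It is primitive if there are no eta quotient $h\neq f$ and positive integer $\nu$ with $f(z)=h(\nu z)$ for all $z\in\mathbb H$. An eta quotient on $\Gamma_0(M)$ is one whose level divides $M$, and a nonconstant holomorphic eta quotient $f$ on $\Gamma_0(M)$ is factorizable on $\Gamma_0(M)$ if $f=g\cdot h$ with nonconstant holomorphic eta quotients $g,h$ on $\Gamma_0(M)$. A holomorphic eta quotient of level $N$ is irreducible if it is not factorizable on $\Gamma_0(M)$ for any positive multiple $M$ of $N$; it is simple if it is primitive and not factorizable on $\Gamma_0(N)$. Suppose that there is a simple (resp. irreducible) holomorphic eta quotient of odd level $N$. Then there are at least two simple (resp. irreducible) holomorphic eta quotients of level $2N$ and at least three of level $4N$. If moreover $3\nmid N$, then there are at least four of level $6N$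 and at least four of level $12N$. Such eta quotients can be constructed as follows. For $f=\prod_d\eta_d^{X_d}$ and $g=\prod_{d'}\eta_{d'}^{Y_{d'}}$ put $f\circledast g=\prod_{d,d'}\eta_{dd'}^{X_dY_{d'}}$, and let $\mathcal Z$ be Zagier's list of eta quotients $$\eta,\ \tfrac{\eta^2}{\eta_2},\ \tfrac{\eta_2^2}{\eta},\ \tfrac{\eta_2^3}{\eta\eta_4},\ \tfrac{\eta_2^5}{\eta^2\eta_4^2},\ \tfrac{\eta\eta_4}{\eta_2},\ \tfrac{\eta\eta_6^2}{\eta_2\eta_3},\ \tfrac{\eta^2\eta_6}{\eta_2\eta_3},\ \tfrac{\eta_2^2\eta_3}{\eta\eta_6},\ \tfrac{\eta_2\eta_3^2}{\eta\eta_6},\ \tfrac{\eta_2^2\eta_3\eta_{12}}{\eta\eta_4\eta_6},\ \tfrac{\eta_2^5\eta_3\eta_{12}}{\eta^2\eta_4^2\eta_6^2},\ \tfrac{\eta\eta_4\eta_6^2}{\eta_2\eta_3\eta_{12}},\ \tfrac{\eta\eta_4\eta_6^5}{\eta_2^2\eta_3^2\eta_{12}^2}.$$ If $f$ is a nonconstant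 eta quotient of odd level $N$ and $g\in\mathcal Z$ has level $M$ coprime to $N$, then $f\circledast g$ has level $MN$ and the same weight as $f$; if $f$ is a simple (resp. irreducible) holomorphic eta quotient, then so is $f\circledast g$; and distinct $g\in\mathcal Z$ of level coprime to $N$ give distinct $f\circledast g$. -/

import Mathlib

open UpperHalfPlane
open scoped MatrixGroups

noncomputable section

namespace EtaQuotient

/-- The point `d z` of the upper half-plane, for a positive integer `d`. -/
def rescale (d : ℕ+) (z : ℍ) : ℍ :=
  ⟨((d : ℕ) : ℂ) * (z : ℂ), by
    have hd : (0 : ℝ) < ((d : ℕ) : ℝ) := by exact_mod_cast d.pos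
    simpa using mul_pos hd z.im_pos⟩

/-- The eta quotient `∏ η(d z) ^ X_d` with exponents `X`, as a function on the upper half-plane.
Here `ModularForm.eta` is Dedekind's function `η(z) = e^(π i z / 12) ∏ (1 - e^(2 π i n z))`. -/
def etaQuotient (X : ℕ+ →₀ ℤ) : ℍ → ℂ :=
  fun z => X.prod fun d a => ModularForm.eta (rescale d z : ℂ) ^ a

/-- The level: the least common multiple of all `d` with `X_d ≠ 0`. -/
def level (X : ℕ+ →₀ ℤ) : ℕ := X.support.lcm fun d => (d : ℕ)

/-- The weight `(∑ X_d) / 2`. -/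
def weight (X : ℕ+ →₀ ℤ) : ℚ := ((X.sum fun _ a => a : ℤ) : ℚ) / 2

/-- The weight `k` action of `γ ∈ SL₂(ℤ)`: the function `z ↦ (c z + d) ^ (-k) f(γ z)`. The power is
the principal one; since `k` is real, its absolute value does not depend on the branch. -/
def slash (k : ℚ) (f : ℍ → ℂ) (γ : SL(2, ℤ)) : ℍ → ℂ :=
  fun z => denom (γ : GL (Fin 2) ℝ) z ^ (-(k : ℂ)) * f (γ • z)

/-- The eta quotient with exponents `X` is holomorphic: it has no pole at any cusp `γ ∞`. (It is
holomorphic and without zeros on the upper half-plane in any case.) -/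
def IsHolomorphic (X : ℕ+ →₀ ℤ) : Prop :=
  ∀ γ : SL(2, ℤ), IsBoundedAtImInfty (slash (weight X) (etaQuotient X) γ)

/-- The eta quotient with exponents `X` is not a constant function. -/
def IsNonconstant (X : ℕ+ →₀ ℤ) : Prop :=
  ¬ ∃ c : ℂ, ∀ z : ℍ, etaQuotient X z = c

/-- There are no eta quotient `h` other than `f = etaQuotient X` and positive integer `ν` with
`f(z) = h(ν z)` for all `z`. -/
def IsPrimitive (X : ℕ+ →₀ ℤ) : Prop :=
  ¬ ∃ (Y : ℕ+ →₀ ℤ) (ν : ℕ+), etaQuotient Y ≠ etaQuotient X ∧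
    ∀ z : ℍ, etaQuotient X z = etaQuotient Y (rescale ν z)

/-- A nonconstant holomorphic eta quotient on `Γ₀(M)`, that is, of level dividing `M`. -/
def IsNonconstantHolomorphicOn (X : ℕ+ →₀ ℤ) (M : ℕ) : Prop :=
  level X ∣ M ∧ IsHolomorphic X ∧ IsNonconstant X

/-- `f` is factorizable on `Γ₀(M)`: `f = g h` where `f`, `g`, `h` are nonconstant holomorphic eta
quotients on `Γ₀(M)`. -/
def IsFactorizableOn (X : ℕ+ →₀ ℤ) (M : ℕ) : Prop :=
  IsNonconstantHolomorphicOn X M ∧ ∃ Y Z : ℕ+ →₀ ℤ,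
    IsNonconstantHolomorphicOn Y M ∧ IsNonconstantHolomorphicOn Z M ∧
    etaQuotient X = etaQuotient Y * etaQuotient Z

/-- A holomorphic eta quotient of level `N` that is not factorizable on `Γ₀(N)`. -/
def IsQuasiIrreducible (X : ℕ+ →₀ ℤ) : Prop :=
  IsHolomorphic X ∧ ¬ IsFactorizableOn X (level X)

/-- A holomorphic eta quotient of level `N` that is not factorizable on `Γ₀(M)` for any positive
multiple `M` of `N`. -/
def IsIrreducible (X : ℕ+ →₀ ℤ) : Prop :=
  IsHolomorphic X ∧ ∀ M : ℕ, 0 < M → level X ∣ M → ¬ IsFactorizableOn X M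

/-- A simple holomorphic eta quotient: primitive and quasi-irreducible. -/
def IsSimple (X : ℕ+ →₀ ℤ) : Prop := IsPrimitive X ∧ IsQuasiIrreducible X

/-- The set of simple holomorphic eta quotients of level `N`, as functions. -/
def simpleOfLevel (N : ℕ) : Set (ℍ → ℂ) :=
  {f | ∃ X : ℕ+ →₀ ℤ, IsSimple X ∧ level X = N ∧ etaQuotient X = f}

/-- The set of irreducible holomorphic eta quotients of level `N`, as functions. -/
def irreducibleOfLevel (N : ℕ) : Set (ℍ → ℂ) :=
  {f | ∃ X : ℕ+ →₀ ℤ, IsIrreducible X ∧ level X = N ∧ etaQuotient X = f}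

/-- The exponents of `f ⊛ g = ∏ η_(d d') ^ (X_d Y_d')`. -/
def circledast (X Y : ℕ+ →₀ ℤ) : ℕ+ →₀ ℤ :=
  X.sum fun d a => Y.sum fun d' b => Finsupp.single (d * d') (a * b)

/-- The exponents given by a list of pairs `(d, X_d)`. -/
def ofPairs (L : List (ℕ+ × ℤ)) : ℕ+ →₀ ℤ :=
  (L.map fun p => Finsupp.single p.1 p.2).sum

/-- Zagier's list of fourteen primitive holomorphic eta quotients of weight `1/2`. -/
def zagierList : List (ℕ+ →₀ ℤ) :=
  [ofPairs [(1, 1)],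
   ofPairs [(1, 2), (2, -1)],
   ofPairs [(2, 2), (1, -1)],
   ofPairs [(2, 3), (1, -1), (4, -1)],
   ofPairs [(2, 5), (1, -2), (4, -2)],
   ofPairs [(1, 1), (4, 1), (2, -1)],
   ofPairs [(1, 1), (6, 2), (2, -1), (3, -1)],
   ofPairs [(1, 2), (6, 1), (2, -1), (3, -1)],
   ofPairs [(2, 2), (3, 1), (1, -1), (6, -1)],
   ofPairs [(2, 1), (3, 2), (1, -1), (6, -1)],
   ofPairs [(2, 2), (3, 1), (12, 1), (1, -1), (4, -1), (6, -1)],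
   ofPairs [(2, 5), (3, 1), (12, 1), (1, -2), (4, -2), (6, -2)],
   ofPairs [(1, 1), (4, 1), (6, 2), (2, -1), (3, -1), (12, -1)],
   ofPairs [(1, 1), (4, 1), (6, 5), (2, -2), (3, -2), (12, -2)]]

end EtaQuotient

end

noncomputable section

namespace EtaQuotient

open Filter Topology

/-! Everything is translated to exponents. Up to a positive factor, the order of `X` at a cusp with
denominator `c` is `cuspOrder X c`, that is, `∑ X_d gcd(d, c)² / d`, so holomorphy means that these
numbers are nonnegative (`isHolomorphic_iff`). The matrix `gcd(c, d)²` is positive definite, so an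
eta quotient determines its exponents (`etaQuotient_injective`).

For coprime levels orders multiply under `⊛` (`cuspOrder_circledast`), so `⊛` preserves holomorphy.
Conversely let `N` and `M` be coprime, and let `contract N` send `η_n` to `η_(gcd(n, N))`. The order
of a contracted quotient is a combination of orders of the original quotient with strictly positive
weights (`exists_weights`, `cuspOrder_contract`). Hence contraction maps holomorphic quotients on
`Γ₀(NM)` to holomorphic ones on `Γ₀(N)` and, by definiteness, sends no nonconstant one to a
constant. When the exponents of `Y` sum to 1, that is, in weight 1/2, contraction undoes `⊛ Y`
(`contract_circledast`). So a factorization of `X ⊛ Y` on `Γ₀(NM)` contracts to one of `X` on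
`Γ₀(N)` (`IsFactorizableOn.of_circledast`).

Zagier's quotients are holomorphic of weight 1/2 and involve `η_1`, which also carries primitivity
over. The lower bounds count list members of levels 2, 4, 6 and 12. -/

/-! ### Growth of eta quotients at the cusps -/

/-- The function `‖η(z)‖ (im z)^(1/4)` is invariant under `SL(2, ℤ)`. -/
lemma log_norm_eta_smul (γ : SL(2, ℤ)) (z : ℍ) :
    Real.log ‖ModularForm.eta (γ • z : ℍ)‖ + 1 / 4 * Real.log (γ • z).im =
      Real.log ‖ModularForm.eta z‖ + 1 / 4 * Real.log z.im := by
  -- `Δ = η^24` is invariant in weight 12. Passing to norms removes the multiplier system of `η`.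
  have h := congrFun (SlashInvariantForm.slash_action_generators_SL2Z
    ModularForm.discriminant_S_invariant ModularForm.discriminant_T_invariant γ) z
  rw [ModularForm.SL_slash_apply] at h
  have hden : denom (γ : GL (Fin 2) ℝ) z ≠ 0 := denom_ne_zero _ _
  have h1 := congrArg (fun x => Real.log ‖x‖) h
  have e1 : ‖ModularForm.eta (γ • z : ℍ)‖ ≠ 0 := by
    simpa using ModularForm.eta_ne_zero (γ • z).2
  simp only [ModularForm.discriminant, norm_mul, norm_pow, norm_zpow] at h1
  rw [Real.log_mul (pow_ne_zero _ e1) (zpow_ne_zero _ (by simp [hden])), Real.log_pow,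
    Real.log_pow, Real.log_zpow] at h1
  have h2 : (γ • z).im = z.im / Complex.normSq (denom (γ : GL (Fin 2) ℝ) z) :=
    ModularGroup.im_smul_eq_div_normSq γ z
  rw [h2, Complex.normSq_eq_norm_sq, Real.log_div z.im_pos.ne' (by simp [hden]),
    Real.log_pow]
  push_cast at h1 ⊢
  linarith

@[simp] lemma rescale_im (d : ℕ+) (z : ℍ) : (rescale d z).im = (d : ℕ) * z.im := by
  change ((d : ℕ) * (z : ℂ) : ℂ).im = _
  simp

@[simp] lemma coe_rescale (d : ℕ+) (z : ℍ) : (rescale d z : ℂ) = (d : ℕ) * (z : ℂ) := rfl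

/-- Reduction of `d γ` to an upper triangular matrix. -/
lemma exists_smul_eq_rescale_smul (d : ℕ+) (γ : SL(2, ℤ)) (z : ℍ) :
    ∃ (γ' : SL(2, ℤ)) (w : ℍ), rescale d (γ • z) = γ' • w ∧
      w.im = (Nat.gcd d (γ 1 0).natAbs : ℝ) ^ 2 / (d : ℕ) * z.im := by
  set a := γ 0 0
  set c := γ 1 0
  have hdet : γ 0 0 * γ 1 1 - γ 0 1 * γ 1 0 = 1 := by
    have := γ.det_coe
    rwa [Matrix.det_fin_two] at this
  have hac : IsCoprime (γ 0 0) (γ 1 0) := ⟨γ 1 1, -γ 0 1, by linarith⟩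
  set g := Nat.gcd d c.natAbs with hg
  have hgpos : 0 < g := Nat.gcd_pos_of_pos_left _ d.pos
  obtain ⟨d₁, hd₁⟩ : g ∣ (d : ℕ) := Nat.gcd_dvd_left _ _
  obtain ⟨c₁, hc₁⟩ : (g : ℤ) ∣ c := Int.natCast_dvd.mpr (Nat.gcd_dvd_right _ _)
  have hcop : IsCoprime ((d₁ : ℤ) * a) c₁ := by
    have h1 : IsCoprime (d₁ : ℤ) c₁ := by
      rw [Int.isCoprime_iff_gcd_eq_one]
      have h2 : g = g * Nat.gcd d₁ c₁.natAbs := by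
        conv_lhs => rw [hg, hd₁, hc₁, Int.natAbs_mul, Int.natAbs_natCast, Nat.gcd_mul_left]
      have := Nat.eq_of_mul_eq_mul_left hgpos ((mul_one g).trans h2)
      simpa [Int.gcd] using this.symm
    have h3 : IsCoprime a c₁ := by
      have : IsCoprime a (c₁ * g) := by rw [mul_comm, ← hc₁]; exact hac
      exact this.of_mul_right_left
    exact h1.mul_left h3
  obtain ⟨u, v, huv⟩ := hcop
  -- The bottom row is chosen to annihilate the first column `(d a, c)` of `diag(d, 1) γ`, since `d
  -- = g d₁` and `c = g c₁`.
  let τ : SL(2, ℤ) := ⟨!![u, v; -c₁, (d₁ : ℤ) * a], by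
    rw [Matrix.det_fin_two_of]; linarith⟩
  refine ⟨τ⁻¹, τ • rescale d (γ • z), by simp, ?_⟩
  rw [ModularGroup.im_smul_eq_div_normSq, rescale_im, ModularGroup.im_smul_eq_div_normSq]
  have hden : denom (γ : GL (Fin 2) ℝ) z ≠ 0 := denom_ne_zero _ _
  have hg0 : (g : ℂ) ≠ 0 := by exact_mod_cast hgpos.ne'
  have hd0 : ((d : ℕ) : ℝ) ≠ 0 := by exact_mod_cast d.ne_zero
  have key : denom (τ : GL (Fin 2) ℝ) (rescale d (γ • z)) * (g * denom (γ : GL (Fin 2) ℝ) z)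
      = (d : ℕ) := by
    have hγz : ((γ • z : ℍ) : ℂ) = ((γ 0 0 : ℤ) * z + (γ 0 1 : ℤ)) / denom (γ : GL (Fin 2) ℝ) z := by
      rw [UpperHalfPlane.specialLinearGroup_apply]
      simp [denom]
    have h1 : denom (τ : GL (Fin 2) ℝ) (rescale d (γ • z)) =
        -(c₁ : ℂ) * ((d : ℕ) * (γ • z : ℍ)) + (d₁ : ℂ) * (a : ℂ) := by
      rw [ModularGroup.denom_apply]
      simp [τ]
    rw [h1, hγz]
    field_simp
    have h2 : denom (γ : GL (Fin 2) ℝ) z = (c : ℤ) * z + (γ 1 1 : ℤ) := by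
      rw [ModularGroup.denom_apply]
    rw [h2]
    have e1 : (c : ℂ) = g * c₁ := by exact_mod_cast congrArg (Int.cast : ℤ → ℂ) hc₁
    have e2 : ((d : ℕ) : ℂ) = g * d₁ := by exact_mod_cast congrArg (Nat.cast : ℕ → ℂ) hd₁
    have e3 : (γ 0 0 : ℂ) * (γ 1 1 : ℤ) - (γ 0 1 : ℤ) * (c : ℤ) = 1 := by exact_mod_cast hdet
    have e4 : (a : ℂ) = (γ 0 0 : ℤ) := rfl
    rw [e4]
    rw [e1] at e3 ⊢
    rw [e2]
    linear_combination (g : ℂ) * d₁ * e3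
  have key2 := congrArg Complex.normSq key
  rw [Complex.normSq_mul, Complex.normSq_mul, Complex.normSq_natCast, Complex.normSq_natCast] at key2
  have n1 : Complex.normSq (denom (γ : GL (Fin 2) ℝ) z) ≠ 0 := by simp [hden]
  have n2 : Complex.normSq (denom (τ : GL (Fin 2) ℝ) (rescale d (γ • z))) ≠ 0 :=
    Complex.normSq_pos.mpr (denom_ne_zero _ _) |>.ne'
  field_simp
  linear_combination -key2

/-- `log ‖η(z)‖ + π im z / 12` tends to zero at `i∞`. -/
lemma tendsto_log_norm_eta :
    Tendsto (fun z : ℍ => Real.log ‖ModularForm.eta z‖ + Real.pi / 12 * z.im) atImInfty (𝓝 0) := by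
  have h := (ModularForm.tendsto_atImInfty_tprod_one_sub_eta_q_pow.norm.log (by simp)).const_mul
    (1 / 24 : ℝ)
  simp only [norm_one, Real.log_one, mul_zero] at h
  refine h.congr fun z => ?_
  have e1 : ‖ModularForm.eta z‖ ≠ 0 := by simpa using ModularForm.eta_ne_zero z.2
  have hΔ := congrArg (fun x => Real.log ‖x‖) (ModularForm.discriminant_eq_q_prod z)
  have hne : ‖∏' n, (1 - ModularForm.eta_q n z) ^ 24‖ ≠ 0 := by
    have := ModularForm.discriminant_ne_zero z
    rw [ModularForm.discriminant_eq_q_prod] at this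
    simpa using (mul_ne_zero_iff.mp this).2
  have hq : ‖Function.Periodic.qParam 1 (z : ℂ)‖ = Real.exp (-2 * Real.pi * z.im) := by
    simp [Function.Periodic.qParam, Complex.norm_exp]
  simp only [ModularForm.discriminant, norm_mul, norm_pow] at hΔ
  rw [Real.log_mul (by simp [hq]) hne, hq, Real.log_exp, Real.log_pow] at hΔ
  push_cast at hΔ
  linarith

/-- A multiple of the order of the eta quotient with exponents `X` at a cusp `a / c`. -/
def cuspOrder (X : ℕ+ →₀ ℤ) (c : ℕ) : ℚ :=
  X.sum fun d a => (a : ℚ) * ((Nat.gcd d c : ℚ) ^ 2 / (d : ℕ))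

lemma etaQuotient_ne_zero (X : ℕ+ →₀ ℤ) (z : ℍ) : etaQuotient X z ≠ 0 :=
  Finset.prod_ne_zero_iff.mpr fun d _ => zpow_ne_zero _ (ModularForm.eta_ne_zero (rescale d z).2)

lemma log_norm_slash (k : ℚ) (X : ℕ+ →₀ ℤ) (γ : SL(2, ℤ)) (z : ℍ) :
    Real.log ‖slash k (etaQuotient X) γ z‖ =
      -k * Real.log ‖denom (γ : GL (Fin 2) ℝ) z‖ + Real.log ‖etaQuotient X (γ • z)‖ := by
  have hden : denom (γ : GL (Fin 2) ℝ) z ≠ 0 := denom_ne_zero _ _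
  have h : ‖denom (γ : GL (Fin 2) ℝ) z ^ (-(k : ℂ))‖ = ‖denom (γ : GL (Fin 2) ℝ) z‖ ^ (-(k : ℝ)) := by
    rw [← Complex.norm_cpow_real]
    norm_cast
  rw [slash, norm_mul, Real.log_mul _ (by simpa using etaQuotient_ne_zero X _), h,
    Real.log_rpow (by simp [hden])]
  rw [h]
  exact (Real.rpow_pos_of_pos (by simp [hden]) _).ne'

lemma log_norm_etaQuotient (X : ℕ+ →₀ ℤ) (z : ℍ) :
    Real.log ‖etaQuotient X z‖ = X.sum fun d a => a * Real.log ‖ModularForm.eta (rescale d z)‖ := by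
  rw [etaQuotient, Finsupp.prod, norm_prod, Real.log_prod]
  · simp [Finsupp.sum, norm_zpow, Real.log_zpow]
  · intro d _
    exact norm_ne_zero_iff.mpr (zpow_ne_zero _ (ModularForm.eta_ne_zero (rescale d z).2))

/-- The growth of a single factor `η_d` at the cusp `γ ∞`. -/
lemma tendsto_log_norm_eta_rescale (d : ℕ+) (γ : SL(2, ℤ)) :
    ∃ C : ℝ, Tendsto (fun z : ℍ => Real.log ‖ModularForm.eta (rescale d (γ • z))‖
      - 1 / 2 * Real.log ‖denom (γ : GL (Fin 2) ℝ) z‖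
      + Real.pi / 12 * ((Nat.gcd d (γ 1 0).natAbs : ℝ) ^ 2 / (d : ℕ)) * z.im) atImInfty (𝓝 C) := by
  choose γ' w hw him using exists_smul_eq_rescale_smul d γ
  set r : ℝ := (Nat.gcd d (γ 1 0).natAbs : ℝ) ^ 2 / (d : ℕ) with hr
  have hdpos : (0 : ℝ) < (d : ℕ) := by exact_mod_cast d.pos
  have hrpos : 0 < r := by
    have : (0 : ℝ) < (Nat.gcd d (γ 1 0).natAbs : ℝ) := by
      exact_mod_cast Nat.gcd_pos_of_pos_left _ d.pos
    positivity
  have hwt : Tendsto w atImInfty atImInfty := by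
    rw [atImInfty, tendsto_comap_iff]
    refine (tendsto_comap.const_mul_atTop hrpos : Tendsto (fun z : ℍ => r * z.im) atImInfty atTop).congr
      fun z => (him z).symm
  -- By invariance `log ‖η(d γ z)‖` exceeds `log ‖η(w)‖` by a quarter of the logarithm of `im w / im
  -- (d γ z) = r ‖denom‖² / d`.
  refine ⟨1 / 4 * Real.log r - 1 / 4 * Real.log (d : ℕ), ?_⟩
  have h := (tendsto_log_norm_eta.comp hwt).add_const
    (1 / 4 * Real.log r - 1 / 4 * Real.log (d : ℕ))
  rw [zero_add] at h
  refine h.congr fun z => ?_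
  have h1 := log_norm_eta_smul (γ' z) (w z)
  rw [← hw, rescale_im, ModularGroup.im_smul_eq_div_normSq] at h1
  have hden : denom (γ : GL (Fin 2) ℝ) z ≠ 0 := denom_ne_zero _ _
  have hn : ‖denom (γ : GL (Fin 2) ℝ) z‖ ^ 2 ≠ 0 := by simp [hden]
  rw [Complex.normSq_eq_norm_sq, Real.log_mul hdpos.ne' (div_ne_zero z.im_pos.ne' hn),
    Real.log_div z.im_pos.ne' hn, Real.log_pow, him z, Real.log_mul hrpos.ne' z.im_pos.ne'] at h1
  simp only [Function.comp_apply, him z]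
  push_cast at h1
  linarith

/-- The growth of an eta quotient at the cusp `γ ∞`. -/
lemma tendsto_log_norm_slash (X : ℕ+ →₀ ℤ) (γ : SL(2, ℤ)) :
    ∃ C : ℝ, Tendsto (fun z : ℍ => Real.log ‖slash (weight X) (etaQuotient X) γ z‖
      + Real.pi / 12 * cuspOrder X (γ 1 0).natAbs * z.im) atImInfty (𝓝 C) := by
  choose C hC using fun d => tendsto_log_norm_eta_rescale d γ
  refine ⟨∑ d ∈ X.support, X d * C d, ?_⟩
  refine (tendsto_finsetSum X.support fun d _ => (hC d).const_mul (X d : ℝ)).congr fun z => ?_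
  rw [log_norm_slash, log_norm_etaQuotient, weight, cuspOrder, Finsupp.sum, Finsupp.sum,
    Finsupp.sum]
  push_cast
  simp only [mul_add, mul_sub, Finset.sum_add_distrib, Finset.sum_sub_distrib, Finset.mul_sum,
    Finset.sum_mul, Finset.sum_div, ← Finset.sum_neg_distrib]
  rw [sub_eq_add_neg, add_comm (Finset.sum _ _) (-_), ← Finset.sum_neg_distrib]
  congr 1
  · congr 1
    refine Finset.sum_congr rfl fun d _ => ?_
    ring
  · refine Finset.sum_congr rfl fun d _ => ?_
    ring

/-- The lower triangular matrix with lower left entry `c`. -/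
def lowerUnipotent (c : ℕ) : SL(2, ℤ) := ⟨!![1, 0; c, 1], by simp⟩

lemma isHolomorphic_iff (X : ℕ+ →₀ ℤ) : IsHolomorphic X ↔ ∀ c : ℕ, 0 ≤ cuspOrder X c := by
  have hne (γ : SL(2, ℤ)) (z : ℍ) : 0 < ‖slash (weight X) (etaQuotient X) γ z‖ := by
    rw [slash, norm_pos_iff]
    refine mul_ne_zero ?_ (etaQuotient_ne_zero X _)
    rw [Complex.cpow_def_of_ne_zero (denom_ne_zero _ _)]
    exact Complex.exp_ne_zero _
  constructor
  · intro h c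
    by_contra! hc
    obtain ⟨C, hC⟩ := tendsto_log_norm_slash X (lowerUnipotent c)
    have hc' : ((lowerUnipotent c) 1 0).natAbs = c := by simp [lowerUnipotent]
    rw [hc'] at hC
    have hb := h (lowerUnipotent c)
    rw [isBoundedAtImInfty_iff] at hb
    obtain ⟨M, A, hM⟩ := hb
    have hcR : (cuspOrder X c : ℝ) < 0 := by exact_mod_cast hc
    have h1 : Tendsto (fun z : ℍ => Real.pi / 12 * (cuspOrder X c : ℝ) * z.im) atImInfty atBot :=
      Tendsto.const_mul_atTop_of_neg (by have := Real.pi_pos; nlinarith) tendsto_comap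
    have h2 := hC.add_atTop (tendsto_neg_atBot_atTop.comp h1)
    have h3 : Tendsto (fun z : ℍ => Real.log
        ‖slash (weight X) (etaQuotient X) (lowerUnipotent c) z‖) atImInfty atTop := by
      refine h2.congr fun z => ?_
      simp
    have h4 := h3.eventually_gt_atTop (Real.log M)
    have h5 : ∀ᶠ z : ℍ in atImInfty, A ≤ z.im := tendsto_comap.eventually_ge_atTop A
    obtain ⟨z, hz4, hz5⟩ := (h4.and h5).exists
    exact absurd (Real.log_le_log (hne _ z) (hM z hz5)) (not_le.mpr hz4)
  · intro h γ
    obtain ⟨C, hC⟩ := tendsto_log_norm_slash X γ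
    have h1 := hC.eventually_le_const (lt_add_one C)
    refine Asymptotics.IsBigO.of_bound (Real.exp (C + 1)) ?_
    filter_upwards [h1] with z hz
    simp only [Pi.one_apply, norm_one, mul_one]
    rw [← Real.log_le_iff_le_exp (hne γ z)]
    have h2 : (0 : ℝ) ≤ cuspOrder X (γ 1 0).natAbs := by exact_mod_cast h _
    have := mul_nonneg (mul_nonneg (by positivity : 0 ≤ Real.pi / 12) h2) z.im_pos.le
    linarith

/-! ### Eta quotients determine their exponents -/

/-- A nonzero order means growth linear in `im z` of the logarithm, whereas a constant leaves only
the automorphy factor. The weight is not yet known to vanish, but that factor contributes only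
`O(log (im z))`; this is compared along `z = i e^y`. -/
lemma cuspOrder_eq_zero_of_const (X : ℕ+ →₀ ℤ) (b : ℂ) (h : ∀ z, etaQuotient X z = b) (c : ℕ) :
    cuspOrder X c = 0 := by
  obtain ⟨C, hC⟩ := tendsto_log_norm_slash X (lowerUnipotent c)
  have hc' : ((lowerUnipotent c) 1 0).natAbs = c := by simp [lowerUnipotent]
  rw [hc'] at hC
  let p : ℝ → ℍ := fun y => ⟨⟨0, Real.exp y⟩, Real.exp_pos y⟩
  have hp (y : ℝ) : (p y).im = Real.exp y := rfl
  have hpt : Tendsto p atTop atImInfty := by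
    rw [atImInfty, tendsto_comap_iff]
    exact Real.tendsto_exp_atTop
  have hinv : Tendsto (fun y : ℝ => Real.exp (-y)) atTop (𝓝 0) := Real.tendsto_exp_neg_atTop_nhds_zero
  have h1 := (hC.comp hpt).mul hinv
  rw [mul_zero] at h1
  have hlog : Tendsto (fun y : ℝ => Real.log ‖denom (lowerUnipotent c : GL (Fin 2) ℝ) (p y)‖ *
      Real.exp (-y)) atTop (𝓝 0) := by
    have hpow : Tendsto (fun y : ℝ => ((Real.log (c + 1)) + y) * Real.exp (-y)) atTop (𝓝 0) := by
      have := (hinv.const_mul (Real.log (c + 1))).add (Real.tendsto_pow_mul_exp_neg_atTop_nhds_zero 1)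
      simp only [mul_zero, add_zero, pow_one] at this
      exact this.congr fun y => by ring
    refine squeeze_zero' ?_ ?_ hpow
    all_goals
      filter_upwards [eventually_ge_atTop 0] with y hy
      have hden : denom (lowerUnipotent c : GL (Fin 2) ℝ) (p y) = c * (p y : ℂ) + 1 := by
        rw [ModularGroup.denom_apply]
        simp [lowerUnipotent]
    · refine mul_nonneg (Real.log_nonneg ?_) (Real.exp_pos _).le
      rw [hden]
      refine le_trans ?_ (Complex.abs_re_le_norm _)
      simp [p]
    · refine mul_le_mul_of_nonneg_right ?_ (Real.exp_pos _).le
      have hne : denom (lowerUnipotent c : GL (Fin 2) ℝ) (p y) ≠ 0 := denom_ne_zero _ _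
      rw [← Real.log_exp y, ← Real.log_mul (by positivity) (Real.exp_pos y).ne', Real.log_exp]
      refine Real.log_le_log (by simp [hne]) ?_
      rw [hden]
      have hpn : ‖(p y : ℂ)‖ = Real.exp y := by
        have : (p y : ℂ) = Real.exp y * Complex.I := by
          apply Complex.ext <;> simp [p, -Complex.ofReal_exp]
        rw [this, norm_mul, Complex.norm_I, mul_one, Complex.norm_real, Real.norm_eq_abs, Real.abs_exp]
      calc _ ≤ ‖(c : ℂ) * (p y : ℂ)‖ + ‖(1 : ℂ)‖ := norm_add_le _ _
        _ = c * Real.exp y + 1 := by rw [norm_mul, hpn]; simp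
        _ ≤ _ := by nlinarith [Real.one_le_exp hy]
  have h2 : Tendsto (fun _ : ℝ => Real.pi / 12 * (cuspOrder X c : ℝ)) atTop (𝓝 0) := by
    have h3 := (h1.add (hlog.const_mul ((weight X : ℚ) : ℝ))).sub (hinv.const_mul (Real.log ‖b‖))
    simp only [mul_zero, add_zero, sub_zero] at h3
    refine h3.congr fun y => ?_
    simp only [Function.comp_apply, log_norm_slash, h, hp]
    have : Real.exp y * Real.exp (-y) = 1 := by rw [← Real.exp_add]; simp
    linear_combination (Real.pi / 12 * (cuspOrder X c : ℝ)) * this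
  have h4 := tendsto_nhds_unique h2 tendsto_const_nhds
  have := Real.pi_ne_zero
  simpa [this] using h4

@[simp] lemma cuspOrder_zero (c : ℕ) : cuspOrder 0 c = 0 := by simp [cuspOrder]

/-- The matrix with entries `gcd(c, d) ^ 2` is positive definite. -/
lemma eq_zero_of_cuspOrder_eq_zero {X : ℕ+ →₀ ℤ} (h : ∀ c ∈ X.support, cuspOrder X c = 0) :
    X = 0 := by
  set s := X.support
  set x : ℕ+ → ℚ := fun d => (X d : ℚ) / (d : ℕ)
  set B := (s.sup fun d => (d : ℕ)) + 1
  have hB : ∀ d ∈ s, (d : ℕ) < B := fun d hd =>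
    Nat.lt_succ_of_le (Finset.le_sup (f := fun d : ℕ+ => (d : ℕ)) hd)
  have hgcd : ∀ c ∈ s, ∀ d : ℕ+, (Nat.gcd d c : ℚ) =
      ∑ a ∈ Finset.range B, if a ∣ (d : ℕ) ∧ a ∣ (c : ℕ) then (Nat.totient a : ℚ) else 0 := by
    intro c hc d
    rw [← Finset.sum_filter]
    have : (Finset.range B).filter (fun a => a ∣ (d : ℕ) ∧ a ∣ (c : ℕ)) = (Nat.gcd d c).divisors := by
      ext a
      simp only [Finset.mem_filter, Finset.mem_range, Nat.mem_divisors, Nat.dvd_gcd_iff]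
      constructor
      · exact fun h => ⟨h.2, (Nat.gcd_pos_of_pos_left _ d.pos).ne'⟩
      · exact fun h => ⟨(Nat.le_of_dvd c.pos h.1.2).trans_lt (hB c hc), h.1⟩
    rw [this, ← Nat.cast_sum, Nat.sum_totient]
  -- Squaring `gcd(d, c) = ∑ φ(a)`, over the common divisors `a`, writes the quadratic form `∑ x_c
  -- x_d gcd(d, c)²` as a sum of squares with coefficients `φ(a) φ(b)`.
  have hq : ∑ a ∈ Finset.range B, ∑ b ∈ Finset.range B, (Nat.totient a : ℚ) * Nat.totient b *
      (∑ d ∈ s, if a ∣ d ∧ b ∣ d then x d else 0) ^ 2 = 0 := by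
    calc _ = ∑ c ∈ s, x c * cuspOrder X c := by
          have hexp : ∀ c ∈ s, x c * cuspOrder X c = ∑ d ∈ s, ∑ a ∈ Finset.range B,
              ∑ b ∈ Finset.range B, (Nat.totient a : ℚ) * Nat.totient b *
                ((if a ∣ c ∧ b ∣ c then x c else 0) * if a ∣ d ∧ b ∣ d then x d else 0) := by
            intro c hc
            rw [cuspOrder, Finsupp.sum, Finset.mul_sum]
            refine Finset.sum_congr rfl fun d _ => ?_
            rw [hgcd c hc d, sq, Finset.sum_mul_sum, Finset.sum_div, Finset.mul_sum,
              Finset.mul_sum]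
            refine Finset.sum_congr rfl fun a _ => ?_
            rw [Finset.sum_div, Finset.mul_sum, Finset.mul_sum]
            refine Finset.sum_congr rfl fun b _ => ?_
            by_cases h1 : a ∣ (d : ℕ) <;> by_cases h2 : a ∣ (c : ℕ) <;> by_cases h3 : b ∣ (d : ℕ) <;>
              by_cases h4 : b ∣ (c : ℕ) <;> simp [h1, h2, h3, h4, x]
            ring
          rw [Finset.sum_congr rfl hexp]
          symm
          rw [Finset.sum_congr rfl fun c _ => Finset.sum_comm, Finset.sum_comm]
          refine Finset.sum_congr rfl fun a _ => ?_
          rw [Finset.sum_congr rfl fun c _ => Finset.sum_comm, Finset.sum_comm]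
          refine Finset.sum_congr rfl fun b _ => ?_
          rw [sq, Finset.sum_mul_sum, Finset.mul_sum]
          exact Finset.sum_congr rfl fun c _ => (Finset.mul_sum _ _ _).symm
      _ = 0 := Finset.sum_eq_zero fun c hc => by rw [h c hc, mul_zero]
  by_contra hX
  -- For `a = b = m`, the largest element of the support, the square is `x_m²`, as no other element
  -- is a multiple of `m`.
  obtain ⟨m, hm, hmax⟩ := s.exists_max_image id (Finsupp.support_nonempty_iff.mpr hX)
  have h1 := (Finset.sum_eq_zero_iff_of_nonneg fun a _ => Finset.sum_nonneg fun b _ => by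
    positivity).mp hq m (Finset.mem_range.mpr (hB m hm))
  have h2 := (Finset.sum_eq_zero_iff_of_nonneg fun b _ => by positivity).mp h1 m
    (Finset.mem_range.mpr (hB m hm))
  have h3 : (∑ d ∈ s, if (m : ℕ) ∣ d ∧ (m : ℕ) ∣ d then x d else 0) = x m := by
    rw [Finset.sum_eq_single_of_mem m hm]
    · simp
    · intro d hd hne
      rw [if_neg]
      rintro ⟨hdvd, -⟩
      exact hne (le_antisymm (hmax d hd) (PNat.le_of_dvd (PNat.dvd_iff.mpr hdvd)))
  rw [h3] at h2
  have hxm : x m ≠ 0 :=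
    div_ne_zero (by exact_mod_cast Finsupp.mem_support_iff.mp hm) (by exact_mod_cast m.ne_zero)
  have hφ : (0 : ℚ) < Nat.totient m := by exact_mod_cast Nat.totient_pos.mpr m.pos
  exact absurd h2 (by positivity)

lemma etaQuotient_zero (z : ℍ) : etaQuotient 0 z = 1 := by simp [etaQuotient]

lemma etaQuotient_add (X Y : ℕ+ →₀ ℤ) :
    etaQuotient (X + Y) = etaQuotient X * etaQuotient Y := by
  ext z
  exact Finsupp.prod_add_index' (by simp)
    fun d _ _ => zpow_add₀ (ModularForm.eta_ne_zero (rescale d z).2) _ _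

lemma isNonconstant_iff (X : ℕ+ →₀ ℤ) : IsNonconstant X ↔ X ≠ 0 := by
  refine ⟨?_, ?_⟩
  · rintro h rfl
    exact h ⟨1, etaQuotient_zero⟩
  · rintro h ⟨b, hb⟩
    exact h (eq_zero_of_cuspOrder_eq_zero fun c _ => cuspOrder_eq_zero_of_const X b hb c)

lemma etaQuotient_injective : Function.Injective etaQuotient := by
  intro X Y h
  by_contra hne
  refine (isNonconstant_iff (X - Y)).mpr (sub_ne_zero.mpr hne) ⟨1, fun z => ?_⟩
  have h1 : etaQuotient (X - Y) * etaQuotient Y = etaQuotient X := by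
    rw [← etaQuotient_add, sub_add_cancel]
  have h2 := congrFun h1 z
  rw [h, Pi.mul_apply] at h2
  exact mul_right_cancel₀ (etaQuotient_ne_zero Y z) (h2.trans (one_mul _).symm)

/-! ### Positive weights on the cusps -/

/-- Summation by parts: `v (j + 1)` multiplies `p^(2j+2) - p^(2j)` for `j < i`, which gives `p^(j+1)
- p^j`, and the sum telescopes. -/
lemma sum_primePow_weights (p i k : ℕ) (v : ℕ → ℚ) (h0 : v 0 = 1)
    (hv : ∀ j, v (j + 1) * (p ^ j * (p + 1)) = 1) :
    ∑ j ∈ Finset.range k, (v j - v (j + 1)) * (p ^ min i j : ℚ) ^ 2 +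
      v k * (p ^ min i k : ℚ) ^ 2 = p ^ min i k := by
  induction k with
  | zero => simp [h0]
  | succ k ih =>
    rw [Finset.sum_range_succ]
    rcases le_or_gt i k with hik | hik
    · rw [min_eq_left hik] at ih ⊢
      rw [min_eq_left (by omega : i ≤ k + 1)]
      linear_combination ih
    · rw [min_eq_right hik.le] at ih ⊢
      rw [min_eq_right (by omega : k + 1 ≤ i), pow_succ]
      linear_combination ih + (p ^ k * (p - 1) : ℚ) * hv k

lemma exists_weights_primePow {p : ℕ} (hp : p.Prime) (k : ℕ) : ∃ w : ℕ → ℚ, (∀ t, 0 < w t) ∧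
    ∀ d, d ∣ p ^ k → ∑ t ∈ (p ^ k).divisors, w t * (Nat.gcd d t : ℚ) ^ 2 = d := by
  have hp0 : (0 : ℚ) < p := by exact_mod_cast hp.pos
  have hp1 : (1 : ℚ) < p := by exact_mod_cast hp.one_lt
  let v : ℕ → ℚ := fun j => if j = 0 then 1 else 1 / (p ^ (j - 1) * (p + 1))
  have hv0 : v 0 = 1 := rfl
  have hvs : ∀ j, v (j + 1) = 1 / (p ^ j * (p + 1)) := fun j => by simp [v]
  have hpos : ∀ j, 0 < v j := by
    rintro (_ | j)
    · simp [hv0]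
    · rw [hvs]; positivity
  have hlt : ∀ j, v (j + 1) < v j := by
    rintro (_ | j)
    · rw [hv0, hvs, div_lt_one (by positivity)]
      simp [hp0]
    · rw [hvs, hvs]
      refine one_div_lt_one_div_of_lt (by positivity) ?_
      exact mul_lt_mul_of_pos_right (pow_lt_pow_right₀ hp1 j.lt_succ_self) (by positivity)
  -- Positive because `v` is positive and strictly decreasing.
  let u : ℕ → ℚ := fun j => if j < k then v j - v (j + 1) else v j
  refine ⟨fun t => u (t.factorization p), fun t => ?_, fun d hd => ?_⟩
  · simp only [u]
    split_ifs
    · exact sub_pos.mpr (hlt _)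
    · exact hpos _
  · obtain ⟨i, hi, rfl⟩ := (Nat.dvd_prime_pow hp).mp hd
    have h := sum_primePow_weights p i k v hv0 fun j => by
      rw [hvs]; field_simp
    rw [min_eq_left hi] at h
    rw [Nat.sum_divisors_prime_pow hp, Finset.sum_range_succ, Nat.cast_pow, ← h]
    have hg : ∀ j, (Nat.gcd (p ^ i) (p ^ j) : ℚ) = p ^ min i j := fun j => by
      rcases le_total i j with h | h
      · rw [Nat.gcd_eq_left (pow_dvd_pow p h), min_eq_left h, Nat.cast_pow]
      · rw [Nat.gcd_eq_right (pow_dvd_pow p h), min_eq_right h, Nat.cast_pow]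
    have hf : ∀ j, (p ^ j).factorization p = j := fun j => by rw [hp.factorization_pow, Finsupp.single_eq_same]
    congr 1
    · refine Finset.sum_congr rfl fun j hj => ?_
      rw [hg]
      simp only [hf, u, if_pos (Finset.mem_range.mp hj)]
    · rw [hg, min_eq_left hi]
      simp only [hf, u, lt_irrefl, if_false]

/-- The cusps of `Γ₀(M)` can be weighted positively so that the weighted sum of the orders of an
eta quotient on `Γ₀(M)` is twice its weight. -/
lemma exists_weights {M : ℕ} (hM : 0 < M) : ∃ w : ℕ → ℚ, (∀ t, 0 < w t) ∧
    ∀ d, d ∣ M → ∑ t ∈ M.divisors, w t * (Nat.gcd d t : ℚ) ^ 2 = d := by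
  revert hM
  induction M using Nat.recOnPosPrimePosCoprime with
  | prime_pow p k hp _ => exact fun _ => exists_weights_primePow hp k
  | zero => exact fun h => absurd h (lt_irrefl 0)
  | one => exact fun _ => ⟨1, by simp, fun d hd => by simp [Nat.dvd_one.mp hd]⟩
  | coprime a b _ _ hab iha ihb =>
    intro hM
    obtain ⟨w₁, p₁, h₁⟩ := iha (Nat.pos_of_mul_pos_right hM)
    obtain ⟨w₂, p₂, h₂⟩ := ihb (Nat.pos_of_mul_pos_left hM)
    -- Both sides of the identity are multiplicative, so weights for coprime `a` and `b` multiply.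
    refine ⟨fun t => w₁ (Nat.gcd t a) * w₂ (Nat.gcd t b), fun t => mul_pos (p₁ _) (p₂ _),
      fun d hd => ?_⟩
    have hd' : (d : ℚ) = Nat.gcd d a * Nat.gcd d b := by
      rw [← Nat.cast_mul, ← hab.gcd_mul, Nat.gcd_eq_left hd]
    rw [hd', ← h₁ _ (Nat.gcd_dvd_right d a), ← h₂ _ (Nat.gcd_dvd_right d b), Finset.sum_mul_sum,
      ← Finset.sum_product', hab.divisors_mul, Finset.sum_map]
    refine (Finset.sum_attach (Nat.divisors a ×ˢ Nat.divisors b)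
      fun q => w₁ (Nat.gcd (q.1 * q.2) a) * w₂ (Nat.gcd (q.1 * q.2) b) *
        (Nat.gcd d (q.1 * q.2) : ℚ) ^ 2).trans ?_
    refine Finset.sum_congr rfl fun q hq => ?_
    obtain ⟨hq₁, hq₂⟩ := Finset.mem_product.mp hq
    have hd₁ := Nat.dvd_of_mem_divisors hq₁
    have hd₂ := Nat.dvd_of_mem_divisors hq₂
    rw [(hab.of_dvd hd₁ hd₂).gcd_mul, (hab.coprime_dvd_right hd₂).symm.gcd_mul_right_cancel,
      (hab.coprime_dvd_left hd₁).gcd_mul_left_cancel, Nat.gcd_eq_left hd₁, Nat.gcd_eq_left hd₂,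
      Nat.gcd_assoc, Nat.gcd_assoc, Nat.gcd_eq_right hd₁, Nat.gcd_eq_right hd₂]
    push_cast
    ring

/-! ### Contraction from level `NM` to level `N` -/

/-- The map induced by `η_n ↦ η_(gcd(n, N))` on eta quotients. -/
def contract (N : ℕ) (Z : ℕ+ →₀ ℤ) : ℕ+ →₀ ℤ :=
  Z.mapDomain fun n : ℕ+ => (Nat.gcd n N).toPNat (Nat.gcd_pos_of_pos_left _ n.pos)

lemma coe_toPNat {n : ℕ} (h : 0 < n) : ((n.toPNat h : ℕ+) : ℕ) = n := rfl

lemma contract_add (N : ℕ) (Y Z : ℕ+ →₀ ℤ) : contract N (Y + Z) = contract N Y + contract N Z :=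
  Finsupp.mapDomain_add

lemma dvd_level {X : ℕ+ →₀ ℤ} {d : ℕ+} (hd : d ∈ X.support) : (d : ℕ) ∣ level X :=
  Finset.dvd_lcm hd

lemma level_dvd_iff {X : ℕ+ →₀ ℤ} {N : ℕ} : level X ∣ N ↔ ∀ d ∈ X.support, (d : ℕ) ∣ N :=
  Finset.lcm_dvd_iff

lemma level_pos (X : ℕ+ →₀ ℤ) : 0 < level X := by
  refine Nat.pos_of_ne_zero fun h => ?_
  obtain ⟨d, -, hd⟩ := Finset.lcm_eq_zero_iff.mp h
  exact d.ne_zero hd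

lemma level_contract_dvd (N : ℕ) (Z : ℕ+ →₀ ℤ) : level (contract N Z) ∣ N := by
  rw [level_dvd_iff]
  intro d hd
  obtain ⟨n, -, rfl⟩ := Finset.mem_image.mp (Finsupp.mapDomain_support hd)
  exact Nat.gcd_dvd_right _ _

lemma eq_gcd_mul_gcd {N M n : ℕ} (h : N.Coprime M) (hn : n ∣ N * M) :
    n = Nat.gcd n N * Nat.gcd n M := by
  rw [← h.gcd_mul, Nat.gcd_eq_left hn]

/-- Each `n ∣ N M` splits into its parts in `N` and `M`, and so does the gcd. The weighted sum over
`t` replaces the squared `M`-part by `gcd(n, M)`, which cancels against the denominator `n`. -/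
lemma cuspOrder_contract {N M : ℕ} (hNM : N.Coprime M) {w : ℕ → ℚ}
    (hw : ∀ d, d ∣ M → ∑ t ∈ M.divisors, w t * (Nat.gcd d t : ℚ) ^ 2 = d)
    {Z : ℕ+ →₀ ℤ} (hZ : level Z ∣ N * M) (c : ℕ) :
    cuspOrder (contract N Z) c = ∑ t ∈ M.divisors, w t * cuspOrder Z (Nat.gcd c N * t) := by
  rw [cuspOrder, contract, Finsupp.sum_mapDomain_index (by simp) (by intros; push_cast; ring)]
  simp only [cuspOrder, Finsupp.sum, Finset.mul_sum, coe_toPNat]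
  rw [Finset.sum_comm]
  refine Finset.sum_congr rfl fun n hn => ?_
  have hnNM := level_dvd_iff.mp hZ n hn
  have hgN : (0 : ℚ) < Nat.gcd n N := by exact_mod_cast Nat.gcd_pos_of_pos_left _ n.pos
  have hgM : (0 : ℚ) < Nat.gcd n M := by exact_mod_cast Nat.gcd_pos_of_pos_left _ n.pos
  have hterm : ∀ t ∈ M.divisors, w t * ((Z n : ℚ) *
      ((Nat.gcd n (Nat.gcd c N * t) : ℚ) ^ 2 / ((n : ℕ) : ℚ))) =
      (Z n : ℚ) * ((Nat.gcd (Nat.gcd n N) c : ℚ) ^ 2 / ((n : ℕ) : ℚ)) *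
        (w t * (Nat.gcd (Nat.gcd n M) t : ℚ) ^ 2) := by
    intro t ht
    have htM := Nat.dvd_of_mem_divisors ht
    have h1 : Nat.gcd n (Nat.gcd c N * t) = Nat.gcd (Nat.gcd n N) c * Nat.gcd (Nat.gcd n M) t := by
      rw [Nat.Coprime.gcd_mul _ (Nat.Coprime.of_dvd (Nat.gcd_dvd_right c N) htM hNM),
        Nat.gcd_assoc, Nat.gcd_assoc, Nat.gcd_eq_right htM, Nat.gcd_comm N c]
    rw [h1]
    push_cast
    ring
  rw [Finset.sum_congr rfl hterm, ← Finset.mul_sum, hw _ (Nat.gcd_dvd_right _ _)]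
  have h2 : ((n : ℕ) : ℚ) = Nat.gcd n N * Nat.gcd n M := by
    exact_mod_cast eq_gcd_mul_gcd hNM hnNM
  rw [h2]
  field_simp

lemma IsHolomorphic.contract {N M : ℕ} (hM : 0 < M) (hNM : N.Coprime M) {Z : ℕ+ →₀ ℤ} (hZ : level Z ∣ N * M)
    (h : IsHolomorphic Z) : IsHolomorphic (contract N Z) := by
  obtain ⟨w, hw0, hw⟩ := exists_weights hM
  rw [isHolomorphic_iff] at h ⊢
  intro c
  rw [cuspOrder_contract hNM hw hZ]
  exact Finset.sum_nonneg fun t _ => mul_nonneg (hw0 t).le (h _)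

lemma contract_ne_zero {N M : ℕ} (hM : 0 < M) (hNM : N.Coprime M) {Z : ℕ+ →₀ ℤ}
    (hZ : level Z ∣ N * M) (h : IsHolomorphic Z) (hne : Z ≠ 0) : contract N Z ≠ 0 := by
  obtain ⟨w, hw0, hw⟩ := exists_weights hM
  rw [isHolomorphic_iff] at h
  intro h0
  refine hne (eq_zero_of_cuspOrder_eq_zero fun n hn => ?_)
  have h1 := cuspOrder_contract hNM hw hZ n
  rw [h0, cuspOrder_zero, eq_comm, Finset.sum_eq_zero_iff_of_nonneg
    fun t _ => mul_nonneg (hw0 t).le (h _)] at h1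
  -- A vanishing sum of nonnegative terms vanishes termwise; this `t` makes the cusp denominator
  -- equal to `n`.
  have h2 := h1 (Nat.gcd n M) (Nat.mem_divisors.mpr ⟨Nat.gcd_dvd_right _ _, hM.ne'⟩)
  rw [← eq_gcd_mul_gcd hNM (level_dvd_iff.mp hZ n hn)] at h2
  exact (mul_eq_zero.mp h2).resolve_left (hw0 _).ne'

/-! ### The product `⊛` for coprime levels -/

lemma sum_circledast {A : Type*} [AddCommMonoid A] (X Y : ℕ+ →₀ ℤ) (f : ℕ+ → ℤ → A)
    (h0 : ∀ n, f n 0 = 0) (hadd : ∀ n a b, f n (a + b) = f n a + f n b) :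
    (circledast X Y).sum f = X.sum fun d a => Y.sum fun d' b => f (d * d') (a * b) := by
  rw [circledast, Finsupp.sum_sum_index h0 hadd]
  refine Finsupp.sum_congr fun d _ => ?_
  rw [Finsupp.sum_sum_index h0 hadd]
  exact Finsupp.sum_congr fun d' _ => Finsupp.sum_single_index (h0 _)

lemma sum_id_circledast (X Y : ℕ+ →₀ ℤ) : ((circledast X Y).sum fun _ a => a) =
    (X.sum fun _ a => a) * Y.sum fun _ a => a := by
  rw [sum_circledast _ _ _ (by simp) (by simp)]
  simp only [Finsupp.sum, Finset.sum_mul_sum]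

lemma weight_circledast (X : ℕ+ →₀ ℤ) {Y : ℕ+ →₀ ℤ} (hY : (Y.sum fun _ a => a) = 1) :
    weight (circledast X Y) = weight X := by
  rw [weight, weight, sum_id_circledast, hY, mul_one]

lemma coprime_of_mem_support {X Y : ℕ+ →₀ ℤ} (h : (level X).Coprime (level Y)) {d d' : ℕ+}
    (hd : d ∈ X.support) (hd' : d' ∈ Y.support) : (d : ℕ).Coprime d' :=
  h.of_dvd (dvd_level hd) (dvd_level hd')

lemma cuspOrder_circledast {X Y : ℕ+ →₀ ℤ} (h : (level X).Coprime (level Y)) (c : ℕ) :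
    cuspOrder (circledast X Y) c = cuspOrder X c * cuspOrder Y c := by
  rw [cuspOrder, sum_circledast _ _ _ (by simp) (by intros; push_cast; ring), cuspOrder,
    cuspOrder]
  simp only [Finsupp.sum, Finset.sum_mul_sum]
  refine Finset.sum_congr rfl fun d hd => Finset.sum_congr rfl fun d' hd' => ?_
  have h1 : Nat.gcd (d * d' : ℕ+) c = Nat.gcd d c * Nat.gcd d' c := by
    rw [PNat.mul_coe, Nat.gcd_comm, (coprime_of_mem_support h hd hd').gcd_mul, Nat.gcd_comm c,
      Nat.gcd_comm c]
  rw [h1]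
  push_cast
  ring

lemma IsHolomorphic.circledast {X Y : ℕ+ →₀ ℤ} (h : (level X).Coprime (level Y))
    (hX : IsHolomorphic X) (hY : IsHolomorphic Y) : IsHolomorphic (circledast X Y) := by
  rw [isHolomorphic_iff] at *
  intro c
  rw [cuspOrder_circledast h]
  exact mul_nonneg (hX c) (hY c)

lemma gcd_mul_eq_left {N d d' : ℕ} (hd : d ∣ N) (hd' : d'.Coprime N) : Nat.gcd (d * d') N = d := by
  rw [hd'.gcd_mul_right_cancel, Nat.gcd_eq_left hd]

/-- Every `η_(d d')` goes to `η_d`, so the exponent of `η_d` is multiplied by the exponent sum of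
`Y`. -/
lemma contract_circledast {X Y : ℕ+ →₀ ℤ} {N : ℕ} (hX : level X ∣ N) (hY : N.Coprime (level Y))
    (hsum : (Y.sum fun _ a => a) = 1) : contract N (circledast X Y) = X := by
  rw [contract, Finsupp.mapDomain, sum_circledast _ _ _ (by simp) (by simp)]
  calc _ = X.sum fun d a => Y.sum fun _ b => Finsupp.single d (a * b) := by
        refine Finsupp.sum_congr fun d hd => Finsupp.sum_congr fun d' hd' => ?_
        congr 1
        refine PNat.eq ?_
        exact gcd_mul_eq_left (level_dvd_iff.mp hX d hd) (hY.symm.coprime_dvd_left (dvd_level hd'))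
    _ = X.sum fun d a => Finsupp.single d a := by
        refine Finsupp.sum_congr fun d _ => ?_
        simp only [Finsupp.sum] at hsum ⊢
        rw [← Finsupp.single_finsetSum, ← Finset.mul_sum, hsum, mul_one]
    _ = X := Finsupp.sum_single X

lemma IsFactorizableOn.of_circledast {X Y : ℕ+ →₀ ℤ} {N M : ℕ} (hM : 0 < M) (hNM : N.Coprime M)
    (hXN : level X ∣ N) (hYM : level Y ∣ M) (hsum : (Y.sum fun _ a => a) = 1)
    (hX : IsHolomorphic X) (h : IsFactorizableOn (circledast X Y) (N * M)) :
    IsFactorizableOn X N := by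
  obtain ⟨⟨-, -, hne⟩, Z₁, Z₂, ⟨l₁, h₁, n₁⟩, ⟨l₂, h₂, n₂⟩, heq⟩ := h
  rw [← etaQuotient_add] at heq
  have heq' := congrArg (contract N) (etaQuotient_injective heq)
  rw [contract_circledast hXN (hNM.coprime_dvd_right hYM) hsum, contract_add] at heq'
  rw [isNonconstant_iff] at hne n₁ n₂
  refine ⟨⟨hXN, hX, ?_⟩, contract N Z₁, contract N Z₂, ⟨level_contract_dvd _ _, h₁.contract hM hNM l₁, ?_⟩,
    ⟨level_contract_dvd _ _, h₂.contract hM hNM l₂, ?_⟩, by rw [← etaQuotient_add, ← heq']⟩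
  · rw [isNonconstant_iff]
    rintro rfl
    exact hne (by simp [circledast])
  · exact (isNonconstant_iff _).mpr (contract_ne_zero hM hNM l₁ h₁ n₁)
  · exact (isNonconstant_iff _).mpr (contract_ne_zero hM hNM l₂ h₂ n₂)

lemma circledast_apply {X Y : ℕ+ →₀ ℤ} {N : ℕ} (hX : level X ∣ N) (hY : N.Coprime (level Y))
    {d d' : ℕ+} (hd : (d : ℕ) ∣ N) (hd' : (d' : ℕ).Coprime N) :
    circledast X Y (d * d') = X d * Y d' := by
  rw [circledast, Finsupp.sum_apply]
  have key : ∀ e ∈ X.support, ∀ e' ∈ Y.support, e * e' = d * d' → e = d ∧ e' = d' := by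
    intro e he e' he' h
    have h1 := congrArg (fun n : ℕ+ => Nat.gcd n N) h
    simp only [PNat.mul_coe] at h1
    rw [gcd_mul_eq_left (level_dvd_iff.mp hX e he) (hY.symm.coprime_dvd_left (dvd_level he')),
      gcd_mul_eq_left hd hd'] at h1
    have h2 := PNat.eq h1
    subst h2
    exact ⟨rfl, mul_left_cancel h⟩
  simp only [Finsupp.sum, Finsupp.finsetSum_apply, Finsupp.single_apply]
  rw [Finset.sum_eq_single d, Finset.sum_eq_single d']
  · simp
  · intro e' _ hne
    rw [if_neg fun h => hne (mul_left_cancel h)]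
  · intro h
    simp [Finsupp.notMem_support_iff.mp h]
  · intro e he hne
    exact Finset.sum_eq_zero fun e' he' => if_neg fun h => hne (key e he e' he' h).1
  · intro h
    simp [Finsupp.notMem_support_iff.mp h]

lemma mem_support_circledast {X Y : ℕ+ →₀ ℤ} (h : (level X).Coprime (level Y)) {d d' : ℕ+}
    (hd : d ∈ X.support) (hd' : d' ∈ Y.support) : d * d' ∈ (circledast X Y).support := by
  rw [Finsupp.mem_support_iff, circledast_apply dvd_rfl h (dvd_level hd)
    (h.symm.coprime_dvd_left (dvd_level hd'))]
  exact mul_ne_zero (Finsupp.mem_support_iff.mp hd) (Finsupp.mem_support_iff.mp hd')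

lemma exists_of_mem_support_circledast {X Y : ℕ+ →₀ ℤ} {n : ℕ+}
    (hn : n ∈ (circledast X Y).support) : ∃ d ∈ X.support, ∃ d' ∈ Y.support, n = d * d' := by
  by_contra! hc
  refine Finsupp.mem_support_iff.mp hn ?_
  simp only [circledast, Finsupp.sum, Finsupp.finsetSum_apply, Finsupp.single_apply]
  exact Finset.sum_eq_zero fun d hd => Finset.sum_eq_zero fun d' hd' =>
    if_neg fun h => hc d hd d' hd' h.symm

lemma level_circledast {X Y : ℕ+ →₀ ℤ} (h : (level X).Coprime (level Y)) (hX : X ≠ 0)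
    (hY : Y ≠ 0) : level (circledast X Y) = level Y * level X := by
  refine Nat.dvd_antisymm (level_dvd_iff.mpr fun n hn => ?_)
    (h.symm.mul_dvd_of_dvd_of_dvd (level_dvd_iff.mpr fun d' hd' => ?_)
      (level_dvd_iff.mpr fun d hd => ?_))
  · obtain ⟨d, hd, d', hd', rfl⟩ := exists_of_mem_support_circledast hn
    rw [mul_comm, PNat.mul_coe]
    exact mul_dvd_mul (dvd_level hd') (dvd_level hd)
  · obtain ⟨d, hd⟩ := Finsupp.support_nonempty_iff.mpr hX
    exact (Dvd.intro_left (d : ℕ) rfl).trans (dvd_level (mem_support_circledast h hd hd'))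
  · obtain ⟨d', hd'⟩ := Finsupp.support_nonempty_iff.mpr hY
    exact (Dvd.intro (d' : ℕ) rfl).trans (dvd_level (mem_support_circledast h hd hd'))

lemma circledast_right_injOn {X : ℕ+ →₀ ℤ} (hX : X ≠ 0) :
    Set.InjOn (circledast X) {Y | (level X).Coprime (level Y)} := by
  intro Y hY Y' hY' h
  obtain ⟨d, hd⟩ := Finsupp.support_nonempty_iff.mpr hX
  ext d'
  by_cases hc : (d' : ℕ).Coprime (level X)
  · have h1 := DFunLike.congr_fun h (d * d')
    rw [circledast_apply dvd_rfl hY (dvd_level hd) hc,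
      circledast_apply dvd_rfl hY' (dvd_level hd) hc] at h1
    exact mul_left_cancel₀ (Finsupp.mem_support_iff.mp hd) h1
  · have hzero : ∀ W : ℕ+ →₀ ℤ, (level X).Coprime (level W) → W d' = 0 := by
      intro W hW
      by_contra h0
      exact hc (hW.symm.coprime_dvd_left (dvd_level (Finsupp.mem_support_iff.mpr h0)))
    rw [hzero Y hY, hzero Y' hY']

/-! ### Primitivity -/

lemma rescale_rescale (d ν : ℕ+) (z : ℍ) : rescale d (rescale ν z) = rescale (ν * d) z := by
  ext
  simp only [coe_rescale, PNat.mul_coe]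
  push_cast
  ring

lemma etaQuotient_rescale (Y : ℕ+ →₀ ℤ) (ν : ℕ+) (z : ℍ) :
    etaQuotient Y (rescale ν z) = etaQuotient (Y.mapDomain (ν * ·)) z := by
  rw [etaQuotient, etaQuotient, Finsupp.prod_mapDomain_index_inj (mul_right_injective ν)]
  simp only [rescale_rescale]

lemma isPrimitive_iff (X : ℕ+ →₀ ℤ) :
    IsPrimitive X ↔ ∀ (Y : ℕ+ →₀ ℤ) (ν : ℕ+), X = Y.mapDomain (ν * ·) → Y = X := by
  refine ⟨fun h Y ν hY => ?_, ?_⟩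
  · by_contra hne
    exact h ⟨Y, ν, etaQuotient_injective.ne hne, fun z => by rw [etaQuotient_rescale, ← hY]⟩
  · rintro h ⟨Y, ν, hne, hY⟩
    exact hne (congrArg etaQuotient (h Y ν (etaQuotient_injective (funext fun z => by
      rw [hY, etaQuotient_rescale]))))

lemma mapDomain_one_mul (X : ℕ+ →₀ ℤ) : X.mapDomain ((1 : ℕ+) * ·) = X := by
  simp only [one_mul]
  exact Finsupp.mapDomain_id

lemma dvd_of_mem_support_mapDomain {Y : ℕ+ →₀ ℤ} {ν n : ℕ+}
    (hn : n ∈ (Y.mapDomain (ν * ·)).support) : ν ∣ n := by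
  obtain ⟨d, -, rfl⟩ := Finset.mem_image.mp (Finsupp.mapDomain_support hn)
  exact Dvd.intro _ rfl

lemma eq_one_of_mapDomain_eq_self {X : ℕ+ →₀ ℤ} (hX : X ≠ 0) {ν : ℕ+}
    (h : X.mapDomain (ν * ·) = X) : ν = 1 := by
  obtain ⟨m, hm, hmax⟩ := X.support.exists_max_image id (Finsupp.support_nonempty_iff.mpr hX)
  have h1 : ν * m ∈ X.support := by
    rw [← h, Finsupp.mapDomain_support_of_injective (mul_right_injective ν)]
    exact Finset.mem_image_of_mem _ hm
  have h2 : ν * m ≤ 1 * m := by simpa using hmax _ h1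
  exact le_antisymm (le_of_mul_le_mul_right' h2) one_le

lemma isPrimitive_of_apply_one_ne_zero {X : ℕ+ →₀ ℤ} (h : X 1 ≠ 0) : IsPrimitive X := by
  rw [isPrimitive_iff]
  rintro Y ν rfl
  have h1 := dvd_of_mem_support_mapDomain (Finsupp.mem_support_iff.mpr h)
  obtain rfl : ν = 1 := PNat.dvd_one_iff ν |>.mp h1
  rw [mapDomain_one_mul]

/-- As `Y 1 ≠ 0`, the support of `X` lies in that of the product. A common factor `ν` of the latter
thus divides the former, and primitivity of `X` forces `ν = 1`. -/
lemma IsPrimitive.circledast {X Y : ℕ+ →₀ ℤ} (h : (level X).Coprime (level Y)) (hX0 : X ≠ 0)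
    (hY : Y 1 ≠ 0) (hX : IsPrimitive X) : IsPrimitive (circledast X Y) := by
  rw [isPrimitive_iff] at *
  intro Z ν hZ
  have hdvd : ∀ d ∈ X.support, ν ∣ d := by
    intro d hd
    have h1 := mem_support_circledast h hd (Finsupp.mem_support_iff.mpr hY)
    rw [mul_one, hZ] at h1
    exact dvd_of_mem_support_mapDomain h1
  have hinj : Function.Injective (ν * · : ℕ+ → ℕ+) := mul_right_injective ν
  have h2 : Finsupp.mapDomain (ν * ·) (Finsupp.comapDomain (ν * ·) X hinj.injOn) = X :=
    Finsupp.mapDomain_comapDomain _ hinj _ fun d hd => by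
      obtain ⟨e, rfl⟩ := hdvd d hd
      exact ⟨e, rfl⟩
  have h3 := hX _ ν h2.symm
  rw [h3] at h2
  obtain rfl := eq_one_of_mapDomain_eq_self hX0 h2
  rw [hZ, mapDomain_one_mul]

/-! ### Transfer of simplicity and irreducibility -/

lemma exists_eq_mul_dvd_pow_coprime (N : ℕ) (M : ℕ) (hM : 0 < M) :
    ∃ a b k, M = a * b ∧ a ∣ N ^ k ∧ b.Coprime N := by
  induction M using Nat.strong_induction_on with
  | _ M ih =>
    by_cases hc : M.Coprime N
    · exact ⟨1, M, 0, by simp, by simp, hc⟩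
    · obtain ⟨m, hm⟩ := Nat.gcd_dvd_left M N
      have hg : 1 < Nat.gcd M N :=
        lt_of_le_of_ne (Nat.gcd_pos_of_pos_left _ hM) (Ne.symm hc)
      have hm0 : 0 < m := Nat.pos_of_ne_zero (by rintro rfl; simp at hm; omega)
      obtain ⟨a, b, k, hab, ha, hb⟩ := ih m (by nlinarith) hm0
      exact ⟨Nat.gcd M N * a, b, k + 1, by rw [mul_assoc, ← hab, ← hm],
        by rw [pow_succ']; exact mul_dvd_mul (Nat.gcd_dvd_right _ _) ha, hb⟩

lemma IsSimple.circledast {X Y : ℕ+ →₀ ℤ} (h : (level X).Coprime (level Y)) (hX0 : X ≠ 0)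
    (hY1 : Y 1 ≠ 0) (hsum : (Y.sum fun _ a => a) = 1) (hY : IsHolomorphic Y) (hX : IsSimple X) :
    IsSimple (circledast X Y) := by
  have hY0 : Y ≠ 0 := by rintro rfl; simp at hY1
  refine ⟨hX.1.circledast h hX0 hY1, hX.2.1.circledast h hY, fun hf => hX.2.2 ?_⟩
  rw [level_circledast h hX0 hY0, mul_comm] at hf
  exact hf.of_circledast (level_pos Y) h dvd_rfl dvd_rfl hsum hX.2.1

lemma IsIrreducible.circledast {X Y : ℕ+ →₀ ℤ} (h : (level X).Coprime (level Y)) (hX0 : X ≠ 0)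
    (hY0 : Y ≠ 0) (hsum : (Y.sum fun _ a => a) = 1) (hY : IsHolomorphic Y)
    (hX : IsIrreducible X) : IsIrreducible (circledast X Y) := by
  refine ⟨hX.1.circledast h hY, fun M hM hdvd hf => ?_⟩
  rw [level_circledast h hX0 hY0] at hdvd
  -- `M` may share with `level X` more than `level X` itself. Contracting to the full part `a`
  -- composed of primes of `level X` keeps the complement `b` coprime; this uses irreducibility of
  -- `X` on `Γ₀(a)`.
  obtain ⟨a, b, k, rfl, ha, hb⟩ := exists_eq_mul_dvd_pow_coprime (level X) M hM
  have hab : a.Coprime b := (hb.symm.pow_left k).coprime_dvd_left ha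
  have hXa : level X ∣ a := hb.symm.dvd_of_dvd_mul_right ((dvd_mul_left _ _).trans hdvd)
  have hYb : level Y ∣ b :=
    ((h.pow_left k).coprime_dvd_left ha).symm.dvd_of_dvd_mul_left ((dvd_mul_right _ _).trans hdvd)
  exact hX.2 a (Nat.pos_of_mul_pos_right hM) hXa
    (hf.of_circledast (Nat.pos_of_mul_pos_left hM) hab hXa hYb hsum hX.1)

/-! ### Zagier's list, by finite computation -/

/-- The exponent of `η_d` in the eta quotient given by a list of pairs. -/
def pairsCoeff (L : List (ℕ+ × ℤ)) (d : ℕ+) : ℤ := (L.map fun p => if p.1 = d then p.2 else 0).sum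

/-- The level of the eta quotient given by a list of pairs. -/
def pairsLevel (L : List (ℕ+ × ℤ)) : ℕ :=
  ((L.map Prod.fst).toFinset.filter fun d => pairsCoeff L d ≠ 0).lcm fun d => (d : ℕ)

lemma sum_ofPairs {A : Type*} [AddCommMonoid A] (L : List (ℕ+ × ℤ)) (f : ℕ+ → ℤ → A)
    (h0 : ∀ n, f n 0 = 0) (hadd : ∀ n a b, f n (a + b) = f n a + f n b) :
    (ofPairs L).sum f = (L.map fun p => f p.1 p.2).sum := by
  induction L with
  | nil => simp [ofPairs]
  | cons p L ih =>
    rw [List.map_cons, List.sum_cons, ← ih, ← Finsupp.sum_single_index (h0 p.1),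
      ← Finsupp.sum_add_index' h0 hadd]
    simp [ofPairs]

lemma ofPairs_apply (L : List (ℕ+ × ℤ)) (d : ℕ+) : ofPairs L d = pairsCoeff L d := by
  induction L with
  | nil => simp [ofPairs, pairsCoeff]
  | cons p L ih =>
    have h : ofPairs (p :: L) = Finsupp.single p.1 p.2 + ofPairs L := by simp [ofPairs]
    rw [h, Finsupp.add_apply, ih, Finsupp.single_apply]
    simp [pairsCoeff]

lemma level_ofPairs (L : List (ℕ+ × ℤ)) : level (ofPairs L) = pairsLevel L := by
  rw [level, pairsLevel]
  congr 1
  ext d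
  rw [Finsupp.mem_support_iff, ofPairs_apply, Finset.mem_filter, List.mem_toFinset]
  refine ⟨fun h => ⟨?_, h⟩, fun h => h.2⟩
  by_contra hd
  refine h (List.sum_eq_zero fun x hx => ?_)
  obtain ⟨p, hp, rfl⟩ := List.mem_map.mp hx
  exact if_neg fun h => hd (List.mem_map.mpr ⟨p, hp, h⟩)

/-- The order depends only on `c` modulo `M`, and multiplying it by `M` makes it an integer, so
holomorphy becomes decidable. -/
lemma isHolomorphic_ofPairs {L : List (ℕ+ × ℤ)} {M : ℕ} (hM : 0 < M) (hL : ∀ p ∈ L, (p.1 : ℕ) ∣ M)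
    (h : ∀ r < M, 0 ≤ (L.map fun p => p.2 * ((Nat.gcd p.1 r ^ 2 * (M / p.1) : ℕ) : ℤ)).sum) :
    IsHolomorphic (ofPairs L) := by
  rw [isHolomorphic_iff]
  intro c
  have key : (M : ℚ) * cuspOrder (ofPairs L) c = ((L.map fun p =>
      p.2 * ((Nat.gcd p.1 (c % M) ^ 2 * (M / p.1) : ℕ) : ℤ)).sum : ℤ) := by
    rw [cuspOrder, sum_ofPairs _ _ (by simp) (by intros; push_cast; ring), ← List.sum_map_mul_left,
      Int.cast_list_sum, List.map_map]
    congr 1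
    refine List.map_congr_left fun p hp => ?_
    obtain ⟨e, he⟩ := hL p hp
    have hp0 : ((p.1 : ℕ) : ℚ) ≠ 0 := by exact_mod_cast p.1.ne_zero
    have h1 : M / (p.1 : ℕ) = e := Nat.div_eq_of_eq_mul_right p.1.pos he
    have h2 : Nat.gcd p.1 (c % M) = Nat.gcd p.1 c := by
      conv_rhs => rw [← Nat.mod_add_div c M, he, mul_assoc, Nat.gcd_add_mul_left_right]
      rw [he]
    simp only [Function.comp_apply, h1, h2]
    rw [he]
    push_cast
    field_simp
  have h1 := h (c % M) (Nat.mod_lt _ hM)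
  have h2 : (0 : ℚ) ≤ M * cuspOrder (ofPairs L) c := by
    rw [key]
    exact_mod_cast h1
  exact nonneg_of_mul_nonneg_right h2 (by exact_mod_cast hM)

/-- The exponents in Zagier's list. -/
def zagierPairs : List (List (ℕ+ × ℤ)) :=
  [[(1, 1)],
   [(1, 2), (2, -1)],
   [(2, 2), (1, -1)],
   [(2, 3), (1, -1), (4, -1)],
   [(2, 5), (1, -2), (4, -2)],
   [(1, 1), (4, 1), (2, -1)],
   [(1, 1), (6, 2), (2, -1), (3, -1)],
   [(1, 2), (6, 1), (2, -1), (3, -1)],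
   [(2, 2), (3, 1), (1, -1), (6, -1)],
   [(2, 1), (3, 2), (1, -1), (6, -1)],
   [(2, 2), (3, 1), (12, 1), (1, -1), (4, -1), (6, -1)],
   [(2, 5), (3, 1), (12, 1), (1, -2), (4, -2), (6, -2)],
   [(1, 1), (4, 1), (6, 2), (2, -1), (3, -1), (12, -1)],
   [(1, 1), (4, 1), (6, 5), (2, -2), (3, -2), (12, -2)]]

lemma zagierList_eq : zagierList = zagierPairs.map ofPairs := rfl

lemma zagierPairs_holomorphic : ∀ L ∈ zagierPairs, (∀ p ∈ L, (p.1 : ℕ) ∣ 12) ∧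
    ∀ r < 12, 0 ≤ (L.map fun p => p.2 * ((Nat.gcd p.1 r ^ 2 * (12 / p.1) : ℕ) : ℤ)).sum := by
  decide +kernel

lemma zagierPairs_coeff : ∀ L ∈ zagierPairs, pairsCoeff L 1 ≠ 0 ∧ (L.map Prod.snd).sum = 1 := by
  decide +kernel

lemma zagierList_properties {Y : ℕ+ →₀ ℤ} (hY : Y ∈ zagierList) :
    IsHolomorphic Y ∧ Y 1 ≠ 0 ∧ (Y.sum fun _ a => a) = 1 := by
  rw [zagierList_eq] at hY
  obtain ⟨L, hL, rfl⟩ := List.mem_map.mp hY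
  obtain ⟨h1, h2⟩ := zagierPairs_holomorphic L hL
  obtain ⟨h3, h4⟩ := zagierPairs_coeff L hL
  refine ⟨isHolomorphic_ofPairs (by norm_num) h1 h2, by rwa [ofPairs_apply], ?_⟩
  rw [sum_ofPairs _ _ (by simp) (by simp)]
  exact h4

/-- The members of Zagier's list of level `M`. -/
def zagierOfLevel (M : ℕ) : Set (ℕ+ →₀ ℤ) := {Y | Y ∈ zagierList ∧ level Y = M}

/-- The exponents of `η_1` and `η_2` suffice to tell apart the list members of a given level that
are counted below. -/
lemma card_le_encard_zagierOfLevel {M k : ℕ} (Q : Finset (ℤ × ℤ)) (hk : Q.card = k)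
    (hQ : ∀ q ∈ Q, ∃ L ∈ zagierPairs, pairsLevel L = M ∧ (pairsCoeff L 1, pairsCoeff L 2) = q) :
    (k : ℕ∞) ≤ (zagierOfLevel M).encard := by
  rw [← hk, ← Set.encard_coe_eq_coe_finsetCard]
  refine le_trans (Set.encard_le_encard fun q hq => ?_)
    (Set.encard_image_le (fun Y : ℕ+ →₀ ℤ => (Y 1, Y 2)) _)
  obtain ⟨L, hL, hM, hq⟩ := hQ q hq
  exact ⟨ofPairs L, ⟨zagierList_eq ▸ List.mem_map_of_mem hL, by rw [level_ofPairs, hM]⟩, by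
    simpa [ofPairs_apply] using hq⟩

lemma two_le_encard_zagierOfLevel_two : 2 ≤ (zagierOfLevel 2).encard :=
  card_le_encard_zagierOfLevel (k := 2) {(2, -1), (-1, 2)} rfl (by decide +kernel)

lemma three_le_encard_zagierOfLevel_four : 3 ≤ (zagierOfLevel 4).encard :=
  card_le_encard_zagierOfLevel (k := 3) {(-1, 3), (-2, 5), (1, -1)} rfl (by decide +kernel)

lemma four_le_encard_zagierOfLevel_six : 4 ≤ (zagierOfLevel 6).encard :=
  card_le_encard_zagierOfLevel (k := 4) {(1, -1), (2, -1), (-1, 2), (-1, 1)} rfl (by decide +kernel)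

lemma four_le_encard_zagierOfLevel_twelve : 4 ≤ (zagierOfLevel 12).encard :=
  card_le_encard_zagierOfLevel (k := 4) {(-1, 2), (-2, 5), (1, -1), (1, -2)} rfl (by decide +kernel)

/-! ### Counting, and the constant quotient -/

/-- Multiplication by the members of Zagier's list of level `M` gives distinct eta quotients. -/
lemma encard_zagierOfLevel_le {X : ℕ+ →₀ ℤ} (hX : X ≠ 0) {M : ℕ} (hM : (level X).Coprime M)
    (S : Set (ℍ → ℂ)) (hS : ∀ Y ∈ zagierOfLevel M, etaQuotient (circledast X Y) ∈ S) :
    (zagierOfLevel M).encard ≤ S.encard := by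
  have hinj : Set.InjOn (fun Y => etaQuotient (circledast X Y)) (zagierOfLevel M) := by
    intro Y hY Y' hY' h
    refine circledast_right_injOn hX ?_ ?_ (etaQuotient_injective h)
    · exact (congrArg (level X).Coprime hY.2).mpr hM
    · exact (congrArg (level X).Coprime hY'.2).mpr hM
  rw [← hinj.encard_image]
  exact Set.encard_le_encard (Set.image_subset_iff.mpr hS)

lemma ne_zero_of_mem_zagierList {Y : ℕ+ →₀ ℤ} (hY : Y ∈ zagierList) : Y ≠ 0 := by
  rintro rfl
  simpa using (zagierList_properties hY).2.1

lemma encard_zagierOfLevel_le_simple {X : ℕ+ →₀ ℤ} (hX : X ≠ 0) (h : IsSimple X) {M : ℕ}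
    (hM : (level X).Coprime M) :
    (zagierOfLevel M).encard ≤ (simpleOfLevel (M * level X)).encard := by
  refine encard_zagierOfLevel_le hX hM _ ?_
  rintro Y ⟨hY, rfl⟩
  obtain ⟨h1, h2, h3⟩ := zagierList_properties hY
  exact ⟨_, h.circledast hM hX h2 h3 h1, level_circledast hM hX (ne_zero_of_mem_zagierList hY), rfl⟩

lemma encard_zagierOfLevel_le_irreducible {X : ℕ+ →₀ ℤ} (hX : X ≠ 0) (h : IsIrreducible X) {M : ℕ}
    (hM : (level X).Coprime M) :
    (zagierOfLevel M).encard ≤ (irreducibleOfLevel (M * level X)).encard := by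
  refine encard_zagierOfLevel_le hX hM _ ?_
  rintro Y ⟨hY, rfl⟩
  obtain ⟨h1, h2, h3⟩ := zagierList_properties hY
  have hY0 := ne_zero_of_mem_zagierList hY
  exact ⟨_, h.circledast hM hX hY0 h3 h1, level_circledast hM hX hY0, rfl⟩

lemma level_single_one : level (Finsupp.single 1 1) = 1 := by
  simp [level]

lemma isHolomorphic_single_one : IsHolomorphic (Finsupp.single 1 1) := by
  rw [isHolomorphic_iff]
  intro c
  simp [cuspOrder]

lemma apply_one_pos_of_level_one {Y : ℕ+ →₀ ℤ} (h : IsNonconstantHolomorphicOn Y 1) : 0 < Y 1 := by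
  obtain ⟨hl, hh, hn⟩ := h
  have hY : Y = Finsupp.single 1 (Y 1) := by
    refine Finsupp.eq_single_iff.mpr ⟨fun d hd => ?_, rfl⟩
    exact Finset.mem_singleton.mpr (PNat.eq (Nat.dvd_one.mp (level_dvd_iff.mp hl d hd)))
  have h1 := (isHolomorphic_iff _).mp hh 1
  rw [hY, cuspOrder, Finsupp.sum_single_index (by simp)] at h1
  have h2 : 0 ≤ Y 1 := by simpa using h1
  refine lt_of_le_of_ne h2 fun h0 => (isNonconstant_iff _).mp hn ?_
  rw [hY, ← h0, Finsupp.single_zero]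

/-- The eta function is irreducible. -/
lemma not_isFactorizableOn_single_one {M : ℕ} (hM : 0 < M) :
    ¬ IsFactorizableOn (Finsupp.single 1 1) M := by
  intro h
  have hc : circledast (Finsupp.single 1 1) (Finsupp.single 1 1) = Finsupp.single 1 1 := by
    rw [circledast, Finsupp.sum_single_index (by simp), Finsupp.sum_single_index (by simp)]
    rfl
  -- Since `η = η ⊛ η`, a factorization on `Γ₀(M)` contracts to level 1, where two positive
  -- exponents would sum to 1.
  rw [← hc, ← one_mul M] at h
  have hl : level (Finsupp.single 1 1) ∣ 1 := level_single_one.dvd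
  obtain ⟨-, Y, Z, hY, hZ, heq⟩ := h.of_circledast hM (Nat.coprime_one_left M) hl
    (hl.trans (one_dvd M)) (by simp) isHolomorphic_single_one
  rw [← etaQuotient_add] at heq
  have h1 := DFunLike.congr_fun (etaQuotient_injective heq) 1
  rw [Finsupp.single_eq_same, Finsupp.add_apply] at h1
  have := apply_one_pos_of_level_one hY
  have := apply_one_pos_of_level_one hZ
  omega

lemma isSimple_single_one : IsSimple (Finsupp.single 1 1) :=
  ⟨isPrimitive_of_apply_one_ne_zero (by simp), isHolomorphic_single_one,
    not_isFactorizableOn_single_one (level_pos _)⟩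

lemma isIrreducible_single_one : IsIrreducible (Finsupp.single 1 1) :=
  ⟨isHolomorphic_single_one, fun _ hM _ => not_isFactorizableOn_single_one hM⟩

/-- The constant 1 has level 1 (an empty lcm) and counts as simple, but `⊛` annihilates it; `η`
takes its place. -/
lemma exists_ne_zero_isSimple {N : ℕ} (h : (simpleOfLevel N).Nonempty) :
    ∃ X : ℕ+ →₀ ℤ, X ≠ 0 ∧ IsSimple X ∧ level X = N := by
  obtain ⟨-, X, hX, hN, -⟩ := h
  by_cases h0 : X = 0
  · refine ⟨Finsupp.single 1 1, by simp, isSimple_single_one, ?_⟩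
    rw [level_single_one, ← hN, h0]
    simp [level]
  · exact ⟨X, h0, hX, hN⟩

lemma exists_ne_zero_isIrreducible {N : ℕ} (h : (irreducibleOfLevel N).Nonempty) :
    ∃ X : ℕ+ →₀ ℤ, X ≠ 0 ∧ IsIrreducible X ∧ level X = N := by
  obtain ⟨-, X, hX, hN, -⟩ := h
  by_cases h0 : X = 0
  · refine ⟨Finsupp.single 1 1, by simp, isIrreducible_single_one, ?_⟩
    rw [level_single_one, ← hN, h0]
    simp [level]
  · exact ⟨X, h0, hX, hN⟩

end EtaQuotient

end

theorem corollary1 (N : ℕ) (hN : Odd N) :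
    -- simple eta quotients
    ((EtaQuotient.simpleOfLevel N).Nonempty →
      2 ≤ (EtaQuotient.simpleOfLevel (2 * N)).encard ∧
      3 ≤ (EtaQuotient.simpleOfLevel (4 * N)).encard ∧
      (¬ 3 ∣ N →
        4 ≤ (EtaQuotient.simpleOfLevel (6 * N)).encard ∧
        4 ≤ (EtaQuotient.simpleOfLevel (12 * N)).encard)) ∧
    -- irreducible eta quotients
    ((EtaQuotient.irreducibleOfLevel N).Nonempty →
      2 ≤ (EtaQuotient.irreducibleOfLevel (2 * N)).encard ∧
      3 ≤ (EtaQuotient.irreducibleOfLevel (4 * N)).encard ∧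
      (¬ 3 ∣ N →
        4 ≤ (EtaQuotient.irreducibleOfLevel (6 * N)).encard ∧
        4 ≤ (EtaQuotient.irreducibleOfLevel (12 * N)).encard)) ∧
    -- the construction
    (∀ X : ℕ+ →₀ ℤ, EtaQuotient.IsNonconstant X → EtaQuotient.level X = N →
      (∀ Y ∈ EtaQuotient.zagierList, Nat.Coprime N (EtaQuotient.level Y) →
        EtaQuotient.level (EtaQuotient.circledast X Y) = EtaQuotient.level Y * N ∧
        EtaQuotient.weight (EtaQuotient.circledast X Y) = EtaQuotient.weight X ∧
        (EtaQuotient.IsSimple X → EtaQuotient.IsSimple (EtaQuotient.circledast X Y)) ∧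
        (EtaQuotient.IsIrreducible X →
          EtaQuotient.IsIrreducible (EtaQuotient.circledast X Y))) ∧
      Set.InjOn (fun Y => EtaQuotient.etaQuotient (EtaQuotient.circledast X Y))
        {Y | Y ∈ EtaQuotient.zagierList ∧ Nat.Coprime N (EtaQuotient.level Y)}) := by
  have h2 : N.Coprime 2 := hN.coprime_two_right
  have h4 : N.Coprime 4 := h2.pow_right 2
  have h6 : ¬ 3 ∣ N → N.Coprime 6 := fun h =>
    h2.mul_right ((Nat.Prime.coprime_iff_not_dvd Nat.prime_three).mpr h).symm
  have h12 : ¬ 3 ∣ N → N.Coprime 12 := fun h =>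
    h4.mul_right ((Nat.Prime.coprime_iff_not_dvd Nat.prime_three).mpr h).symm
  refine ⟨fun h => ?_, fun h => ?_, fun X hX hXN => ⟨fun Y hY hc => ?_, ?_⟩⟩
  · obtain ⟨X, hX, hs, rfl⟩ := EtaQuotient.exists_ne_zero_isSimple h
    exact ⟨EtaQuotient.two_le_encard_zagierOfLevel_two.trans (EtaQuotient.encard_zagierOfLevel_le_simple hX hs h2),
      EtaQuotient.three_le_encard_zagierOfLevel_four.trans (EtaQuotient.encard_zagierOfLevel_le_simple hX hs h4),
      fun h3 =>
        ⟨EtaQuotient.four_le_encard_zagierOfLevel_six.trans (EtaQuotient.encard_zagierOfLevel_le_simple hX hs (h6 h3)),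
        EtaQuotient.four_le_encard_zagierOfLevel_twelve.trans
          (EtaQuotient.encard_zagierOfLevel_le_simple hX hs (h12 h3))⟩⟩
  · obtain ⟨X, hX, hs, rfl⟩ := EtaQuotient.exists_ne_zero_isIrreducible h
    exact ⟨EtaQuotient.two_le_encard_zagierOfLevel_two.trans (EtaQuotient.encard_zagierOfLevel_le_irreducible hX hs h2),
      EtaQuotient.three_le_encard_zagierOfLevel_four.trans (EtaQuotient.encard_zagierOfLevel_le_irreducible hX hs h4),
      fun h3 =>
        ⟨EtaQuotient.four_le_encard_zagierOfLevel_six.trans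
          (EtaQuotient.encard_zagierOfLevel_le_irreducible hX hs (h6 h3)),
        EtaQuotient.four_le_encard_zagierOfLevel_twelve.trans
          (EtaQuotient.encard_zagierOfLevel_le_irreducible hX hs (h12 h3))⟩⟩
  · subst hXN
    rw [EtaQuotient.isNonconstant_iff] at hX
    obtain ⟨p1, p2, p3⟩ := EtaQuotient.zagierList_properties hY
    have hY0 := EtaQuotient.ne_zero_of_mem_zagierList hY
    exact ⟨EtaQuotient.level_circledast hc hX hY0, EtaQuotient.weight_circledast X p3,
      fun hs => hs.circledast hc hX p2 p3 p1, fun hs => hs.circledast hc hX hY0 p3 p1⟩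
  · subst hXN
    rw [EtaQuotient.isNonconstant_iff] at hX
    intro Y hY Y' hY' h
    exact EtaQuotient.circledast_right_injOn hX hY.2 hY'.2 (EtaQuotient.etaQuotient_injective h)
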